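/- Let $d\ge 1$. For real-valued $V\in L^\infty_c(\mathbb R\times\mathbb R^d)$ (essentially bounded with compact support), let $$B_V:=\int_{\mathbb R} e^{-it\Delta}\,V(t,x)\,e^{it\Delta}\,dt ,$$ a bounded operator on $L^2(\mathbb R^d)$, where $V(t,x)$ denotes multiplication by $V(t,\cdot)$ and $e^{it\Delta}$ is the free Schrödinger group; the integral is taken in the strong sense. (1) Assume that $V\neq 0$, that $V\ge 0$ almost everywhere, and that the space-time Fourier transform $$\widehat V(\omega,k)=(2\pi)^{-\frac{d+1}{2}}\int_{\mathbb R}\int_{\mathbb R^d}e^{-i(\omega t+k\cdot x)}V(t,x)\,dx\,dt$$ is non-negative for all $(\omega,k)\in\mathbb R\times\mathbb R^d$. Then $B_V^{d+1}$ is a non-negative operator and $$\operatorname{Tr}\big(B_V^{\,d+1}\big)=+\infty .$$ (2) Consequently the dual Strichartz inequality in Schatten spaces fails at the end point $(p',q')=\big(d+1,\tfrac{d+1}{2}\big)$: there is no constant $C<\infty$ such that $$\|B_V\|_{\mathfrak S^{2q'}}\le C\,\|V\|_{L^{p'}_t(\mathbb R,L^{q'}_x(\mathbb R^d))}\qquad\text{for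 all real-valued } V\in L^\infty_c(\mathbb R\times\mathbb R^d),$$ where $\|T\|_{\mathfrak S^r}=\big(\operatorname{Tr}|T|^r\big)^{1/r}\in[0,\infty]$. -/

import Mathlib

open MeasureTheory Set Filter Topology
open scoped ENNReal NNReal InnerProductSpace FourierTransform

namespace EndPoint

noncomputable section

/-! ### The trace and the Schatten norms on a complex Hilbert space -/

section Trace

variable {H : Type*} [NormedAddCommGroup H] [InnerProductSpace ℂ H]

theorem tsum_enorm_inner_sq {ι : Type*} (b : HilbertBasis ι ℂ H) (x : H) :
    ∑' i, ENNReal.ofReal (‖⟪b i, x⟫_ℂ‖ ^ 2) = ENNReal.ofReal (‖x‖ ^ 2) := by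
  have h := b.hasSum_inner_mul_inner x x
  have h2 : HasSum (fun i => ‖⟪b i, x⟫_ℂ‖ ^ 2) (‖x‖ ^ 2) := by
    have h3 := Complex.hasSum_re h
    have e1 : ∀ i, (⟪x, b i⟫_ℂ * ⟪b i, x⟫_ℂ).re = ‖⟪b i, x⟫_ℂ‖ ^ 2 := by
      intro i
      rw [← inner_conj_symm x (b i), Complex.conj_mul']
      norm_cast
    have e2 : (⟪x, x⟫_ℂ).re = ‖x‖ ^ 2 := by
      rw [inner_self_eq_norm_sq_to_K]
      norm_cast
    simpa only [e1, e2] using h3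
  rw [← h2.tsum_eq, ENNReal.ofReal_tsum_of_nonneg (fun i => by positivity) h2.summable]

variable [CompleteSpace H]

/-- The trace in `[0, ∞]` of a non-negative bounded operator `A`: the sum of `⟨e, A e⟩` over the
vectors `e` of a Hilbert basis. By `posTrace_eq` every Hilbert basis gives the same value. -/
def posTrace (A : H →L[ℂ] H) : ℝ≥0∞ :=
  ∑' e : (exists_hilbertBasis ℂ H).choose, ENNReal.ofReal (RCLike.re ⟪(e : H), A e⟫_ℂ)

theorem tsum_adjoint {ι κ : Type*} (b : HilbertBasis ι ℂ H) (c : HilbertBasis κ ℂ H)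
    (S : H →L[ℂ] H) :
    ∑' i, ENNReal.ofReal (‖S (b i)‖ ^ 2)
      = ∑' j, ENNReal.ofReal (‖ContinuousLinearMap.adjoint S (c j)‖ ^ 2) := by
  simp_rw [← tsum_enorm_inner_sq c (S (b _)), ← tsum_enorm_inner_sq b
    (ContinuousLinearMap.adjoint S (c _))]
  rw [ENNReal.tsum_comm]
  refine tsum_congr fun j => tsum_congr fun i => ?_
  rw [ContinuousLinearMap.adjoint_inner_right, norm_inner_symm]

/-- The trace of a non-negative operator can be computed in any Hilbert basis. -/
theorem posTrace_eq {ι : Type*} (b : HilbertBasis ι ℂ H) {A : H →L[ℂ] H} (hA : A.IsPositive) :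
    posTrace A = ∑' i, ENNReal.ofReal (RCLike.re ⟪b i, A (b i)⟫_ℂ) := by
  have h0 : (0 : H →L[ℂ] H) ≤ A := (ContinuousLinearMap.nonneg_iff_isPositive A).2 hA
  set S : H →L[ℂ] H := CFC.sqrt A with hS
  have hSA : S * S = A := CFC.sqrt_mul_sqrt_self A h0
  have hadj : ContinuousLinearMap.adjoint S = S :=
    ((ContinuousLinearMap.nonneg_iff_isPositive S).1 (CFC.sqrt_nonneg A)).isSelfAdjoint.adjoint_eq
  have key : ∀ x : H, RCLike.re ⟪x, A x⟫_ℂ = ‖S x‖ ^ 2 := by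
    intro x
    rw [← hSA, mul_apply_eq_comp, ← ContinuousLinearMap.adjoint_inner_left, hadj,
      inner_self_eq_norm_sq]
  obtain ⟨b', hb'⟩ := (exists_hilbertBasis ℂ H).choose_spec
  have h1 := tsum_adjoint b' b S
  have h2 := tsum_adjoint b b S
  rw [← h2] at h1
  simp only [posTrace, key]
  rw [← h1, hb']

/-- The Schatten norm `‖T‖_{𝔖^r} = (Tr |T|^r)^{1/r} ∈ [0, ∞]` of a bounded operator, `0 < r < ∞`. -/
def schattenNorm (r : ℝ) (T : H →L[ℂ] H) : ℝ≥0∞ :=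
  posTrace (CFC.abs T ^ r) ^ (1 / r)

end Trace

/-! ### Multiplication operators and the free Schrödinger group on `L²(ℝᵈ)` -/

/-- The space `ℝᵈ` with its Euclidean structure. -/
abbrev Space (d : ℕ) : Type := EuclideanSpace ℝ (Fin d)

/-- The Hilbert space `L²(ℝᵈ)`. -/
abbrev L2 (d : ℕ) : Type := Lp ℂ 2 (volume : Measure (Space d))

open Classical in
/-- Multiplication by an essentially bounded function `φ`, as a bounded operator on `L²(ℝᵈ)`
(and `0` if `φ` is not essentially bounded). -/
def mulOp {d : ℕ} (φ : Space d → ℂ) : L2 d →L[ℂ] L2 d :=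
  if h : MemLp φ ∞ (volume : Measure (Space d)) then
    (ContinuousLinearMap.mul ℂ ℂ).holderL volume ∞ 2 2 (h.toLp φ)
  else 0

/-- The unitary operator `e^{itΔ}` on `L²(ℝᵈ)`: in Fourier space, with the normalisation
`∫ e^{-2πi⟨x, ξ⟩} f(x) dx`, it is multiplication by `e^{-it|2πξ|²}`. -/
def freeEvolution (d : ℕ) (t : ℝ) : L2 d →L[ℂ] L2 d :=
  ((Lp.fourierTransformₗᵢ (Space d) ℂ).symm : L2 d →L[ℂ] L2 d) ∘L
    mulOp (fun ξ => Complex.exp (-(Complex.I * ((t * (2 * Real.pi * ‖ξ‖) ^ 2 : ℝ) : ℂ)))) ∘L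
      (Lp.fourierTransformₗᵢ (Space d) ℂ : L2 d →L[ℂ] L2 d)

/-- The operator `e^{-itΔ} V(t, x) e^{itΔ}`. -/
def evolvedPotential {d : ℕ} (V : ℝ × Space d → ℝ) (t : ℝ) : L2 d →L[ℂ] L2 d :=
  freeEvolution d (-t) ∘L mulOp (fun x => ((V (t, x) : ℝ) : ℂ)) ∘L freeEvolution d t

/-- `V ∈ L^∞_c(ℝ × ℝᵈ)`: (the class of) `V` is essentially bounded with compact support. -/
structure MemLinftyc {d : ℕ} (V : ℝ × Space d → ℝ) : Prop where
  memLp : MemLp V ∞ (volume : Measure (ℝ × Space d))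
  support : ∃ K : Set (ℝ × Space d), IsCompact K ∧ ∀ᵐ z, z ∉ K → V z = 0

theorem mulOp_of_memLp {d : ℕ} {φ : Space d → ℂ} (h : MemLp φ ∞ (volume : Measure (Space d))) :
    mulOp φ = (ContinuousLinearMap.mul ℂ ℂ).holderL volume ∞ 2 2 (h.toLp φ) := by
  simp only [mulOp, h, dite_true]

theorem coeFn_mulOp {d : ℕ} {φ : Space d → ℂ} (h : MemLp φ ∞ (volume : Measure (Space d)))
    (f : L2 d) : mulOp φ f =ᵐ[volume] fun x => φ x * f x := by
  rw [mulOp_of_memLp h]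
  filter_upwards [(ContinuousLinearMap.mul ℂ ℂ).coeFn_holder (r := 2) (h.toLp φ) f, h.coeFn_toLp]
    with x hx hx'
  rw [← hx']
  exact hx

theorem mulOp_congr {d : ℕ} {φ ψ : Space d → ℂ} (h : φ =ᵐ[volume] ψ) : mulOp φ = mulOp ψ := by
  by_cases h1 : MemLp φ ∞ (volume : Measure (Space d))
  · have h2 := (memLp_congr_ae h).1 h1
    rw [mulOp_of_memLp h1, mulOp_of_memLp h2, (MemLp.toLp_eq_toLp_iff h1 h2).2 h]
  · have h2 : ¬ MemLp ψ ∞ (volume : Measure (Space d)) := fun h2 => h1 ((memLp_congr_ae h).2 h2)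
    simp only [mulOp, h1, h2, dite_false]

theorem norm_mulOp_apply_le {d : ℕ} {φ : Space d → ℂ} {C : ℝ} (hC : 0 ≤ C)
    (h : ∀ᵐ x, ‖φ x‖ ≤ C) (f : L2 d) : ‖mulOp φ f‖ ≤ C * ‖f‖ := by
  by_cases h1 : MemLp φ ∞ (volume : Measure (Space d))
  · refine Lp.norm_le_mul_norm_of_ae_le_mul ?_
    filter_upwards [coeFn_mulOp h1 f, h] with x hx hx'
    rw [hx, norm_mul]
    gcongr
  · simp only [mulOp, h1, dite_false, zero_apply, norm_zero]
    positivity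

theorem norm_freeEvolution_apply_le (d : ℕ) (t : ℝ) (f : L2 d) : ‖freeEvolution d t f‖ ≤ ‖f‖ := by
  have h1 : ∀ g : L2 d, ‖(Lp.fourierTransformₗᵢ (Space d) ℂ).symm g‖ = ‖g‖ :=
    (Lp.fourierTransformₗᵢ (Space d) ℂ).symm.norm_map
  have h2 : ‖Lp.fourierTransformₗᵢ (Space d) ℂ f‖ = ‖f‖ :=
    (Lp.fourierTransformₗᵢ (Space d) ℂ).norm_map f
  have h3 := norm_mulOp_apply_le (d := d) (C := 1)
    (φ := fun ξ => Complex.exp (-(Complex.I * ((t * (2 * Real.pi * ‖ξ‖) ^ 2 : ℝ) : ℂ))))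
    zero_le_one (by
      refine Eventually.of_forall fun ξ => ?_
      rw [← mul_neg, ← Complex.ofReal_neg, mul_comm]
      exact (Complex.norm_exp_ofReal_mul_I _).le)
    (Lp.fourierTransformₗᵢ (Space d) ℂ f)
  rw [h2, one_mul] at h3
  exact (h1 _).trans_le h3

/-! #### Measurability in time -/

theorem measurable_of_dist {α X : Type*} [MeasurableSpace α] [PseudoMetricSpace X]
    [SecondCountableTopology X] [MeasurableSpace X] [BorelSpace X] {f : α → X}
    (h : ∀ a, Measurable fun t => dist (f t) a) : Measurable f := by
  refine measurable_of_isOpen fun U hU => ?_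
  choose! r hr using fun x (hx : x ∈ U) => Metric.isOpen_iff.1 hU x hx
  obtain ⟨T, hTc, hTU⟩ := TopologicalSpace.isOpen_iUnion_countable
    (fun x : U => Metric.ball (x : X) (r x)) (fun _ => Metric.isOpen_ball)
  have hU' : U = ⋃ x ∈ T, Metric.ball (x : X) (r x) := by
    rw [hTU]
    ext y
    simp only [mem_iUnion]
    constructor
    · intro hy
      exact ⟨⟨y, hy⟩, Metric.mem_ball_self (hr y hy).1⟩
    · rintro ⟨x, hx⟩
      exact (hr x x.2).2 hx
  rw [hU', preimage_iUnion₂]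
  refine MeasurableSet.biUnion hTc fun x _ => ?_
  exact measurableSet_lt (h x) measurable_const

theorem memLp_slice {d : ℕ} {W : ℝ × Space d → ℂ} (hW : StronglyMeasurable W) {C : ℝ}
    (hC : ∀ z, ‖W z‖ ≤ C) (t : ℝ) : MemLp (fun x => W (t, x)) ∞ (volume : Measure (Space d)) :=
  memLp_top_of_bound (hW.comp_measurable measurable_prodMk_left).aestronglyMeasurable C
    (Eventually.of_forall fun _ => hC _)

theorem stronglyMeasurable_mulOp {d : ℕ} {W : ℝ × Space d → ℂ} (hW : StronglyMeasurable W) {C : ℝ}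
    (hC : ∀ z, ‖W z‖ ≤ C) {g : ℝ → L2 d} (hg : StronglyMeasurable g) :
    StronglyMeasurable fun t => mulOp (fun x => W (t, x)) (g t) := by
  borelize (L2 d)
  have : Fact ((2 : ℝ≥0∞) ≠ ∞) := ⟨by norm_num⟩
  have h1 : ∀ b : L2 d, StronglyMeasurable fun t => mulOp (fun x => W (t, x)) b := by
    intro b
    refine (measurable_of_dist fun a => ?_).stronglyMeasurable
    have : ∀ t, dist (mulOp (fun x => W (t, x)) b) a
        = ((∫⁻ x, ‖W (t, x) * b x - a x‖ₑ ^ (2 : ℝ)) ^ (1 / (2 : ℝ))).toReal := by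
      intro t
      rw [Lp.dist_def, eLpNorm_eq_lintegral_rpow_enorm_toReal (by norm_num) (by norm_num)]
      congr 2
      refine lintegral_congr_ae ?_
      filter_upwards [coeFn_mulOp (memLp_slice hW hC t) b] with x hx
      simp [hx]
    simp_rw [this]
    refine Measurable.ennreal_toReal (Measurable.pow_const ?_ _)
    refine Measurable.lintegral_prod_right' (f := fun z : ℝ × Space d =>
      ‖W z * b z.2 - a z.2‖ₑ ^ (2 : ℝ)) ?_
    have hb := (Lp.stronglyMeasurable b).measurable
    have ha := (Lp.stronglyMeasurable a).measurable
    have hWm := hW.measurable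
    fun_prop
  have h2 : StronglyMeasurable (Function.uncurry fun (b : L2 d) (t : ℝ) =>
      mulOp (fun x => W (t, x)) b) :=
    stronglyMeasurable_uncurry_of_continuous_of_stronglyMeasurable
      (fun t => (mulOp (fun x => W (t, x))).continuous) h1
  exact h2.comp_measurable (hg.measurable.prodMk measurable_id)

theorem stronglyMeasurable_freeEvolution {d : ℕ} {s : ℝ → ℝ} (hs : Measurable s) {g : ℝ → L2 d}
    (hg : StronglyMeasurable g) : StronglyMeasurable fun t => freeEvolution d (s t) (g t) := by
  have h1 : StronglyMeasurable fun t => Lp.fourierTransformₗᵢ (Space d) ℂ (g t) :=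
    (Lp.fourierTransformₗᵢ (Space d) ℂ).continuous.comp_stronglyMeasurable hg
  have h2 := stronglyMeasurable_mulOp (d := d) (C := 1) (W := fun z : ℝ × Space d =>
    Complex.exp (-(Complex.I * ((s z.1 * (2 * Real.pi * ‖z.2‖) ^ 2 : ℝ) : ℂ))))
    (by
      refine Measurable.stronglyMeasurable ?_
      fun_prop)
    (by
      intro z
      rw [← mul_neg, ← Complex.ofReal_neg, mul_comm]
      exact (Complex.norm_exp_ofReal_mul_I _).le) h1
  exact (Lp.fourierTransformₗᵢ (Space d) ℂ).symm.continuous.comp_stronglyMeasurable h2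

theorem exists_dominated {d : ℕ} {V : ℝ × Space d → ℝ} (hV : MemLinftyc V) :
    ∃ β : ℝ → ℝ, Integrable β ∧ ∀ f : L2 d,
      AEStronglyMeasurable (fun t => evolvedPotential V t f) ∧
      ∀ᵐ t, ‖evolvedPotential V t f‖ ≤ β t * ‖f‖ := by
  obtain ⟨K, hK, hKV⟩ := hV.support
  set C : ℝ := (eLpNorm V ∞ volume).toReal with hCdef
  have hC0 : 0 ≤ C := ENNReal.toReal_nonneg
  have hVC : ∀ᵐ z, ‖V z‖ ≤ C := by
    have h := ae_le_eLpNormEssSup (f := V) (μ := volume)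
    filter_upwards [h] with z hz
    rw [← eLpNorm_exponent_top] at hz
    have := ENNReal.toReal_mono hV.memLp.2.ne hz
    simpa [hCdef] using this
  set V₀ := hV.memLp.1.mk V with hV₀
  have hV₀m : StronglyMeasurable V₀ := hV.memLp.1.stronglyMeasurable_mk
  have hV₀e : V =ᵐ[volume] V₀ := hV.memLp.1.ae_eq_mk
  set W : ℝ × Space d → ℂ := fun z => ((max (-C) (min (V₀ z) C) : ℝ) : ℂ) with hWdef
  have hWm : StronglyMeasurable W := by
    refine Measurable.stronglyMeasurable ?_
    have := hV₀m.measurable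
    fun_prop
  have hWC : ∀ z, ‖W z‖ ≤ C := by
    intro z
    rw [hWdef, Complex.norm_real, Real.norm_eq_abs, abs_le]
    exact ⟨le_max_left _ _, max_le (by linarith) (min_le_right _ _)⟩
  have hWV : ∀ᵐ z, ((V z : ℝ) : ℂ) = W z := by
    filter_upwards [hV₀e, hVC] with z hz hz'
    rw [Real.norm_eq_abs, abs_le] at hz'
    simp only [hWdef]
    rw [← hz, min_eq_left hz'.2, max_eq_right hz'.1]
  have hslice : ∀ᵐ t : ℝ, mulOp (fun x : Space d => ((V (t, x) : ℝ) : ℂ))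
      = mulOp fun x => W (t, x) := by
    filter_upwards [Measure.ae_ae_of_ae_prod hWV] with t ht
    exact mulOp_congr ht
  refine ⟨(Prod.fst '' K).indicator fun _ => C, ?_, fun f => ⟨?_, ?_⟩⟩
  · have hK1 : IsCompact (Prod.fst '' K) := hK.image continuous_fst
    exact (integrable_indicator_iff hK1.measurableSet).2
      (integrableOn_const hK1.measure_lt_top.ne)
  · have h1 : StronglyMeasurable fun t => freeEvolution d t f :=
      stronglyMeasurable_freeEvolution measurable_id stronglyMeasurable_const
    have h2 := stronglyMeasurable_freeEvolution measurable_neg (stronglyMeasurable_mulOp hWm hWC h1)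
    refine h2.aestronglyMeasurable.congr ?_
    filter_upwards [hslice] with t ht
    simp only [evolvedPotential, ContinuousLinearMap.comp_apply, ht]
  · filter_upwards [Measure.ae_ae_of_ae_prod hVC, Measure.ae_ae_of_ae_prod hKV] with t ht ht'
    have hβ : ∀ᵐ x : Space d,
        ‖((V (t, x) : ℝ) : ℂ)‖ ≤ (Prod.fst '' K).indicator (fun _ => C) t := by
      filter_upwards [ht, ht'] with x hx hx'
      rw [Complex.norm_real]
      by_cases h : t ∈ Prod.fst '' K
      · simpa only [h, indicator_of_mem] using hx
      · rw [hx' fun hz => h ⟨_, hz, rfl⟩, norm_zero, indicator_of_notMem h]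
    have hβ0 : 0 ≤ (Prod.fst '' K).indicator (fun _ => C) t :=
      indicator_nonneg (fun _ _ => hC0) t
    calc ‖evolvedPotential V t f‖
        ≤ ‖mulOp (fun x => ((V (t, x) : ℝ) : ℂ)) (freeEvolution d t f)‖ :=
          norm_freeEvolution_apply_le d (-t) _
      _ ≤ _ * ‖freeEvolution d t f‖ := norm_mulOp_apply_le hβ0 hβ _
      _ ≤ _ * ‖f‖ := by
          gcongr
          exact norm_freeEvolution_apply_le d t f

theorem integrable_evolvedPotential {d : ℕ} {V : ℝ × Space d → ℝ} (hV : MemLinftyc V) (f : L2 d) :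
    Integrable fun t => evolvedPotential V t f := by
  obtain ⟨β, hβ, h⟩ := exists_dominated hV
  exact (hβ.mul_const ‖f‖).mono' (h f).1 (h f).2

/-- The bounded operator `∫ e^{-itΔ} V(t, x) e^{itΔ} dt` on `L²(ℝᵈ)`, for `V ∈ L^∞_c(ℝ × ℝᵈ)`:
it maps `f` to the (Bochner) integral of the `L²`-valued function `t ↦ e^{-itΔ} V(t, x) e^{itΔ} f`,
which is integrable by `integrable_evolvedPotential`. -/
def timeAverage {d : ℕ} (V : ℝ × Space d → ℝ) (hV : MemLinftyc V) : L2 d →L[ℂ] L2 d :=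
  LinearMap.mkContinuousOfExistsBound
    { toFun := fun f => ∫ t : ℝ, evolvedPotential V t f
      map_add' := fun f g => by
        simp only [map_add]
        exact integral_add (integrable_evolvedPotential hV f) (integrable_evolvedPotential hV g)
      map_smul' := fun c f => by
        simp only [map_smul, RingHom.id_apply]
        exact integral_smul c _ }
    (by
      obtain ⟨β, hβ, h⟩ := exists_dominated hV
      refine ⟨∫ t, β t, fun f => ?_⟩
      rw [← integral_mul_const]
      exact norm_integral_le_of_norm_le (hβ.mul_const ‖f‖) (h f).2)

/-! ### The space-time Fourier transform, mixed norms, and the dual Strichartz inequality -/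

/-- The Fourier transform of `V` in both space and time,
`(2π)^{-(d+1)/2} ∫∫ e^{-i(ωt + ⟨k, x⟩)} V(t, x) dt dx`. -/
def spaceTimeFourier {d : ℕ} (V : ℝ × Space d → ℝ) (ω : ℝ) (k : Space d) : ℂ :=
  (((2 * Real.pi) ^ (-((d : ℝ) + 1) / 2) : ℝ) : ℂ) *
    ∫ z : ℝ × Space d,
      Complex.exp (-(Complex.I * ((ω * z.1 + ⟪k, z.2⟫_ℝ : ℝ) : ℂ))) * ((V z : ℝ) : ℂ)

/-- The mixed norm `‖V‖_{L^p_t(ℝ, L^q_x(ℝᵈ))} ∈ [0, ∞]`. -/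
def mixedNorm {d : ℕ} (p q : ℝ) (V : ℝ × Space d → ℝ) : ℝ≥0∞ :=
  eLpNorm (fun t : ℝ => eLpNorm (fun x : Space d => V (t, x)) (ENNReal.ofReal q) volume)
    (ENNReal.ofReal p) volume

/-- The dual Strichartz inequality in dimension `d` with exponents `(p', q')`: for some finite `C`,
`‖∫ e^{-itΔ} V(t, x) e^{itΔ} dt‖_{𝔖^{2q'}} ≤ C ‖V‖_{L^{p'}_t(ℝ, L^{q'}_x(ℝᵈ))}` for all real
`V ∈ L^∞_c(ℝ × ℝᵈ)`. -/
def DualStrichartz (d : ℕ) (p' q' : ℝ) : Prop :=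
  ∃ C : ℝ≥0, ∀ (V : ℝ × Space d → ℝ) (hV : MemLinftyc V),
    schattenNorm (2 * q') (timeAverage V hV) ≤ C * mixedNorm p' q' V

end

end EndPoint

namespace EndPoint

noncomputable section

/-! ### Positive operators: Jensen's inequality, orthonormal families and traces -/

section PositiveOperators

variable {H : Type*} [NormedAddCommGroup H] [InnerProductSpace ℂ H] [CompleteSpace H]

/-! Since `V ≥ 0`, the form `⟨f, B f⟩ = ∫∫ V |e^{itΔ} f|²` is non-negative, hence `B` and its powers
are positive. For divergence of the trace, `B` is tested on wave packets `f_Q` whose Fourier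
transform is the normalised indicator of a set `Q`. If `ξ` and `|ξ|²` both vary by at most a small
`δ` on `Q`, all plane waves with frequency in `Q` are nearly in phase on the support of `V`. There
`|e^{itΔ} f_Q|² ≥ |Q| / 4`, so `⟨f_Q, B f_Q⟩ ≥ c |Q|` (`exists_mul_measure_le_inner_timeAverage`).

Disjoint sets `Q` give orthonormal packets, and Jensen's inequality (`re_inner_pow_le`) gives `Tr
B^{d+1} ≥ ∑ (c |Q|)^{d+1}` (`tsum_measure_pow_le_posTrace`). The sets are cubes of side `s` cut by
energy shells `|ξ|² ∈ [δm, δ(m+1))`. A cube with `max n = k` meets `O(k+1)` shells, so by the power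
mean inequality its cells contribute at least a constant times `(k+1)^{-d}`. At least `(k+1)^{d-1}`
cubes have `max n = k`, so the sum dominates the harmonic series (`tsum_volume_freqCell_pow`).

For the second claim, `2q' = d + 1` and `|B| = B`. The Schatten norm is therefore infinite for the
indicator of a product of balls, whose mixed norm is finite. -/

theorem isPositive_pow {B : H →L[ℂ] H} (hB : B.IsPositive) (n : ℕ) : (B ^ n).IsPositive := by
  have h0 : (0 : H →L[ℂ] H) ≤ B := (ContinuousLinearMap.nonneg_iff_isPositive B).2 hB
  rw [← ContinuousLinearMap.nonneg_iff_isPositive, ← cfc_pow_id (R := ℝ) B n hB.isSelfAdjoint]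
  exact cfc_nonneg fun x hx => pow_nonneg (spectrum_nonneg_of_nonneg h0 hx) n

/-- The tangent line inequality `nlⁿ⁻¹(x - l) ≤ xⁿ - lⁿ`. -/
theorem tangent_le_pow {x l : ℝ} (hx : 0 ≤ x) (hl : 0 ≤ l) (n : ℕ) :
    (n + 1) * l ^ n * x - n * l ^ (n + 1) ≤ x ^ (n + 1) := by
  induction n with
  | zero => simp
  | succ n ih =>
    have h1 := mul_le_mul_of_nonneg_right ih hx
    have h2 : 0 ≤ l ^ n * (x - l) ^ 2 := by positivity
    push_cast
    have h3 : (0 : ℝ) ≤ n * (l ^ n * (x - l) ^ 2) := by positivity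
    ring_nf at h1 h2 h3 ⊢
    linarith

/-- Jensen's inequality for powers of a non-negative operator in a normalised state. -/
theorem re_inner_pow_le {B : H →L[ℂ] H} (hB : B.IsPositive) {f : H} (hf : ‖f‖ = 1) (n : ℕ) :
    RCLike.re ⟪f, B f⟫_ℂ ^ (n + 1) ≤ RCLike.re ⟪f, (B ^ (n + 1)) f⟫_ℂ := by
  have h0 : (0 : H →L[ℂ] H) ≤ B := (ContinuousLinearMap.nonneg_iff_isPositive B).2 hB
  have hsa : IsSelfAdjoint B := hB.isSelfAdjoint
  set l : ℝ := RCLike.re ⟪f, B f⟫_ℂ with hl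
  have hl0 : 0 ≤ l := hB.re_inner_nonneg_right f
  -- The tangent inequality at `l = ⟨f, B f⟩` passes to operators by functional calculus; tested on
  -- the unit vector `f`, its left side becomes exactly `l ^ (n + 1)`.
  have h1 : (((n + 1) * l ^ n : ℝ) • B : H →L[ℂ] H) - ((n * l ^ (n + 1) : ℝ) • 1) ≤ B ^ (n + 1) := by
    have e1 : (((n + 1) * l ^ n : ℝ) • B : H →L[ℂ] H) - ((n * l ^ (n + 1) : ℝ) • 1)
        = cfc (fun x : ℝ => (n + 1) * l ^ n * x - n * l ^ (n + 1)) B := by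
      rw [cfc_sub (fun x : ℝ => (n + 1) * l ^ n * x) (fun _ => n * l ^ (n + 1)) B,
        cfc_const_mul_id _ B, cfc_const _ B, Algebra.algebraMap_eq_smul_one]
    rw [e1, ← cfc_pow_id (R := ℝ) B (n + 1)]
    exact cfc_mono fun x hx => tangent_le_pow (spectrum_nonneg_of_nonneg h0 hx) hl0 n
  have h2 := ((ContinuousLinearMap.le_def _ _).1 h1).re_inner_nonneg_right f
  have e2 : ∀ (c : ℝ) (g : H), RCLike.re ⟪f, c • g⟫_ℂ = c * RCLike.re ⟪f, g⟫_ℂ := by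
    intro c g
    rw [← Complex.coe_smul, inner_smul_right]
    simp
  simp only [sub_apply, smul_apply, inner_sub_right, map_sub, e2,
    one_apply_eq_self, inner_self_eq_norm_sq, hf, ← hl] at h2
  ring_nf at h2 ⊢
  linarith

/-- An orthonormal family extends to a Hilbert basis, and the additional diagonal terms can only
increase the sum. -/
theorem tsum_le_posTrace {A : H →L[ℂ] H} (hA : A.IsPositive) {ι : Type*} {v : ι → H}
    (hv : Orthonormal ℂ v) :
    ∑' i, ENNReal.ofReal (RCLike.re ⟪v i, A (v i)⟫_ℂ) ≤ posTrace A := by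
  obtain ⟨w, b, hw, hb⟩ := hv.toSubtypeRange.exists_hilbertBasis_extension
  rw [posTrace_eq b hA, hb]
  let j : ι → w := fun i => ⟨v i, hw (mem_range_self i)⟩
  have hj : Function.Injective j := fun a c h =>
    hv.linearIndependent.injective (congrArg Subtype.val h)
  exact ENNReal.tsum_comp_le_tsum_of_injective hj
    fun e : w => ENNReal.ofReal (RCLike.re ⟪(e : H), A e⟫_ℂ)

theorem schattenNorm_eq_top {B : H →L[ℂ] H} (hB : B.IsPositive) {n : ℕ}
    (h : posTrace (B ^ (n + 1)) = ∞) : schattenNorm ((n : ℝ) + 1) B = ∞ := by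
  have h0 : (0 : H →L[ℂ] H) ≤ B := (ContinuousLinearMap.nonneg_iff_isPositive B).2 hB
  have e : CFC.abs B ^ ((n : ℝ) + 1) = B ^ (n + 1) := by
    rw [CFC.abs_of_nonneg B h0, ← CFC.rpow_natCast B (n + 1) h0]
    push_cast
    rfl
  rw [schattenNorm, e, h]
  exact ENNReal.top_rpow_of_pos (by positivity)

end PositiveOperators

/-! ### The inverse Fourier transform on `L²` as an integral -/

theorem integral_smul_fourierInv_eq {d : ℕ} {f g : Space d → ℂ} (hf : Integrable f)
    (hg : Integrable g) : ∫ x, 𝓕⁻ f x • g x = ∫ x, f x • 𝓕⁻ g x := by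
  have hL : Continuous fun p : Space d × Space d => (-(innerₗ (Space d))) p.1 p.2 := by
    simp only [LinearMap.neg_apply, innerₗ_apply_apply]
    fun_prop
  have h := VectorFourier.integral_fourierIntegral_smul_eq_flip (μ := volume) (ν := volume)
    Real.continuous_fourierChar hL hf hg
  have hflip : (-(innerₗ (Space d))).flip = -(innerₗ (Space d)) := by
    ext x y
    simp [real_inner_comm]
  rw [hflip] at h
  simpa only [VectorFourier.fourierIntegral, Real.fourierInv_eq, LinearMap.neg_apply, neg_neg,
    innerₗ_apply_apply] using h

/-- Both sides have the same integrals against smooth compactly supported functions: the left as a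
tempered distribution, the right by Fubini. This makes wave packets explicit pointwise. -/
theorem fourierInv_coeFn_ae_eq {d : ℕ} (g : L2 d) (hg : Integrable g) :
    (Lp.fourierTransformₗᵢ (Space d) ℂ).symm g =ᵐ[volume] 𝓕⁻ (g : Space d → ℂ) := by
  have hcont : Continuous (𝓕⁻ (g : Space d → ℂ)) := by
    have h := ((Real.Lp.fourierTransformInv (memLp_one_iff_integrable.2 hg).toLp)).continuous
    rwa [Real.Lp.fourierTransformInv_toLp] at h
  refine ae_eq_of_integral_contDiff_smul_eq
    ((Lp.memLp _).locallyIntegrable (by norm_num)) hcont.locallyIntegrable fun ψ hψ hψc => ?_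
  have h1 : HasCompactSupport (Complex.ofRealCLM ∘ ψ) := hψc.comp_left rfl
  set φ := h1.toSchwartzMap (Complex.ofRealCLM.contDiff.comp hψ)
  have h3 := congrArg (fun T => T φ) (Lp.fourierInv_toTemperedDistribution_eq g)
  simp only [TemperedDistribution.fourierInv_apply, Lp.toTemperedDistribution_apply] at h3
  have h4 := integral_smul_fourierInv_eq φ.integrable hg
  rw [← SchwartzMap.fourierInv_coe, h3] at h4
  exact h4

/-! ### Quadratic forms of multiplication operators and of the time average -/

theorem inner_mulOp {d : ℕ} {φ : Space d → ℂ} (hφ : MemLp φ ∞ volume) (f g : L2 d) :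
    ⟪f, mulOp φ g⟫_ℂ = ⟪mulOp (fun x => starRingEnd ℂ (φ x)) f, g⟫_ℂ := by
  have hφ' : MemLp (fun x => starRingEnd ℂ (φ x)) ∞ (volume : Measure (Space d)) := hφ.star
  rw [L2.inner_def, L2.inner_def]
  refine integral_congr_ae ?_
  filter_upwards [coeFn_mulOp hφ g, coeFn_mulOp hφ' f] with x h1 h2
  rw [h1, h2]
  simp only [RCLike.inner_apply, map_mul, Complex.conj_conj]
  ring

theorem inner_mulOp_self {d : ℕ} {φ : Space d → ℝ}
    (hφ : MemLp (fun x => (φ x : ℂ)) ∞ volume) (f : L2 d) :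
    ⟪f, mulOp (fun x => (φ x : ℂ)) f⟫_ℂ = ((∫ x, φ x * ‖f x‖ ^ 2 : ℝ) : ℂ) := by
  rw [L2.inner_def, ← integral_complex_ofReal]
  refine integral_congr_ae ?_
  filter_upwards [coeFn_mulOp hφ f] with x h
  rw [h]
  simp only [RCLike.inner_apply, mul_assoc, Complex.mul_conj']
  push_cast
  ring

/-- The symbol of `e^{itΔ}`. -/
def freeSymbol {d : ℕ} (t : ℝ) (ξ : Space d) : ℂ :=
  Complex.exp (-(Complex.I * ((t * (2 * Real.pi * ‖ξ‖) ^ 2 : ℝ) : ℂ)))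

theorem norm_freeSymbol {d : ℕ} (t : ℝ) (ξ : Space d) : ‖freeSymbol t ξ‖ = 1 := by
  rw [freeSymbol, ← mul_neg, ← Complex.ofReal_neg, mul_comm]
  exact Complex.norm_exp_ofReal_mul_I _

theorem continuous_freeSymbol {d : ℕ} (t : ℝ) : Continuous (freeSymbol (d := d) t) := by
  unfold freeSymbol
  fun_prop

theorem memLp_freeSymbol {d : ℕ} (t : ℝ) :
    MemLp (freeSymbol (d := d) t) ∞ (volume : Measure (Space d)) :=
  memLp_top_of_bound (continuous_freeSymbol t).aestronglyMeasurable 1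
    (Eventually.of_forall fun ξ => (norm_freeSymbol t ξ).le)

theorem conj_freeSymbol {d : ℕ} (t : ℝ) (ξ : Space d) :
    starRingEnd ℂ (freeSymbol t ξ) = freeSymbol (-t) ξ := by
  rw [freeSymbol, freeSymbol, ← Complex.exp_conj]
  simp only [map_neg, map_mul, Complex.conj_I, Complex.conj_ofReal]
  congr 1
  push_cast
  ring

/-- The adjoint of `e^{itΔ}` is `e^{-itΔ}`, because conjugating the symbol reverses time. -/
theorem inner_freeEvolution_neg {d : ℕ} (t : ℝ) (f g : L2 d) :
    ⟪f, freeEvolution d (-t) g⟫_ℂ = ⟪freeEvolution d t f, g⟫_ℂ := by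
  set F := Lp.fourierTransformₗᵢ (Space d) ℂ
  have h1 : ⟪f, F.symm (mulOp (freeSymbol (-t)) (F g))⟫_ℂ
      = ⟪F f, mulOp (freeSymbol (-t)) (F g)⟫_ℂ := by
    rw [← F.inner_map_map f, F.apply_symm_apply]
  have h2 : ⟪F.symm (mulOp (freeSymbol t) (F f)), g⟫_ℂ = ⟪mulOp (freeSymbol t) (F f), F g⟫_ℂ := by
    rw [← F.inner_map_map _ g, F.apply_symm_apply]
  have h3 := inner_mulOp (memLp_freeSymbol (-t)) (F f) (F g)
  simp only [conj_freeSymbol, neg_neg] at h3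
  exact h1.trans (h3.trans h2.symm)

theorem inner_timeAverage {d : ℕ} {V : ℝ × Space d → ℝ} (hV : MemLinftyc V) (f : L2 d) :
    ⟪f, timeAverage V hV f⟫_ℂ = ∫ t : ℝ, ⟪f, evolvedPotential V t f⟫_ℂ :=
  (integral_inner (integrable_evolvedPotential hV f) f).symm

theorem memLp_top_slice {d : ℕ} {V : ℝ × Space d → ℝ} (hV : MemLinftyc V) :
    ∀ᵐ t : ℝ, MemLp (fun x : Space d => ((V (t, x) : ℝ) : ℂ)) ∞ volume := by
  obtain ⟨C, hC⟩ : ∃ C : ℝ, ∀ᵐ z, ‖V z‖ ≤ C := by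
    refine ⟨(eLpNorm V ∞ volume).toReal, ?_⟩
    filter_upwards [ae_le_eLpNormEssSup (f := V) (μ := volume)] with z hz
    rw [← eLpNorm_exponent_top] at hz
    simpa using ENNReal.toReal_mono hV.memLp.2.ne hz
  filter_upwards [hV.memLp.1.prodMk_left, Measure.ae_ae_of_ae_prod hC] with t h1 h2
  refine memLp_top_of_bound (Complex.continuous_ofReal.comp_aestronglyMeasurable h1) C ?_
  filter_upwards [h2] with x hx
  rwa [Complex.norm_real]

theorem inner_evolvedPotential {d : ℕ} {V : ℝ × Space d → ℝ} (hV : MemLinftyc V) (f : L2 d) :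
    ∀ᵐ t : ℝ, ⟪f, evolvedPotential V t f⟫_ℂ
      = ((∫ x, V (t, x) * ‖freeEvolution d t f x‖ ^ 2 : ℝ) : ℂ) := by
  filter_upwards [memLp_top_slice hV] with t ht
  exact (inner_freeEvolution_neg t f _).trans (inner_mulOp_self ht _)

theorem inner_timeAverage_eq_integral {d : ℕ} {V : ℝ × Space d → ℝ} (hV : MemLinftyc V)
    (f : L2 d) : ⟪f, timeAverage V hV f⟫_ℂ
      = ((∫ t : ℝ, ∫ x, V (t, x) * ‖freeEvolution d t f x‖ ^ 2 : ℝ) : ℂ) := by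
  rw [inner_timeAverage, ← integral_complex_ofReal]
  exact integral_congr_ae (inner_evolvedPotential hV f)

theorem isPositive_timeAverage {d : ℕ} {V : ℝ × Space d → ℝ} (hV : MemLinftyc V)
    (h0 : ∀ᵐ z, 0 ≤ V z) : (timeAverage V hV).IsPositive := by
  rw [ContinuousLinearMap.isPositive_iff_complex]
  intro f
  rw [← inner_conj_symm, inner_timeAverage_eq_integral hV f, Complex.conj_ofReal]
  refine ⟨by simp, ?_⟩
  rw [RCLike.re_to_complex, Complex.ofReal_re]
  refine integral_nonneg_of_ae ?_
  filter_upwards [Measure.ae_ae_of_ae_prod h0] with t ht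
  refine integral_nonneg_of_ae ?_
  filter_upwards [ht] with x hx
  positivity

/-! ### Wave packets -/

/-- The unit vector of `L²(ℝᵈ)` whose Fourier transform is the normalised indicator of `Q`. -/
def wavePacket {d : ℕ} {Q : Set (Space d)} (hQ : MeasurableSet Q) (hQt : volume Q ≠ ∞) : L2 d :=
  (Lp.fourierTransformₗᵢ (Space d) ℂ).symm
    (indicatorConstLp 2 hQ hQt (((√(volume.real Q))⁻¹ : ℝ) : ℂ))

theorem norm_wavePacket {d : ℕ} {Q : Set (Space d)} (hQ : MeasurableSet Q) (hQt : volume Q ≠ ∞)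
    (hQ0 : volume Q ≠ 0) : ‖wavePacket hQ hQt‖ = 1 := by
  have hpos : 0 < volume.real Q := ENNReal.toReal_pos hQ0 hQt
  rw [wavePacket, LinearIsometryEquiv.norm_map, norm_indicatorConstLp (by norm_num) (by norm_num),
    Complex.norm_real, Real.norm_of_nonneg (by positivity), ENNReal.toReal_ofNat,
    ← Real.sqrt_eq_rpow]
  exact inv_mul_cancel₀ (by positivity)

theorem inner_wavePacket_of_disjoint {d : ℕ} {Q Q' : Set (Space d)} (hQ : MeasurableSet Q)
    (hQt : volume Q ≠ ∞) (hQ' : MeasurableSet Q') (hQt' : volume Q' ≠ ∞) (h : Disjoint Q Q') :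
    ⟪wavePacket hQ hQt, wavePacket hQ' hQt'⟫_ℂ = 0 := by
  rw [wavePacket, wavePacket, LinearIsometryEquiv.inner_map_map,
    L2.inner_indicatorConstLp_indicatorConstLp hQ hQ', h.inter_eq]
  simp

/-- The phase of the plane wave of frequency `ξ` at the space-time point `(t, x)`. -/
def phase {d : ℕ} (t : ℝ) (x ξ : Space d) : ℝ :=
  2 * Real.pi * ⟪ξ, x⟫_ℝ - t * (2 * Real.pi * ‖ξ‖) ^ 2

theorem continuous_phase {d : ℕ} (t : ℝ) (x : Space d) : Continuous (phase t x) := by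
  unfold phase
  fun_prop

/-- In Fourier space the evolved packet is a bounded function supported in `Q`, hence integrable, so
inversion is an honest integral. -/
theorem freeEvolution_wavePacket_ae_eq {d : ℕ} {Q : Set (Space d)} (hQ : MeasurableSet Q)
    (hQt : volume Q ≠ ∞) (t : ℝ) :
    freeEvolution d t (wavePacket hQ hQt) =ᵐ[volume] fun x =>
      (((√(volume.real Q))⁻¹ : ℝ) : ℂ) * ∫ ξ in Q, Complex.exp (phase t x ξ * Complex.I) := by
  set c : ℂ := (((√(volume.real Q))⁻¹ : ℝ) : ℂ) with hc
  set g : L2 d := mulOp (freeSymbol t) (indicatorConstLp 2 hQ hQt c) with hg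
  have hg' : g =ᵐ[volume] Q.indicator fun ξ => freeSymbol t ξ * c := by
    filter_upwards [coeFn_mulOp (memLp_freeSymbol t) (indicatorConstLp 2 hQ hQt c),
      indicatorConstLp_coeFn (p := 2) (hs := hQ) (hμs := hQt) (c := c)] with ξ h1 h2
    rw [h1, h2]
    by_cases h : ξ ∈ Q <;> simp [h]
  have hint : Integrable g := by
    refine Integrable.congr ?_ hg'.symm
    rw [integrable_indicator_iff hQ]
    refine Integrable.mono' (g := fun _ => ‖c‖) (integrableOn_const hQt)
      ((continuous_freeSymbol t).mul continuous_const).aestronglyMeasurable ?_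
    exact Eventually.of_forall fun ξ => by rw [norm_mul, norm_freeSymbol, one_mul]
  have h0 : freeEvolution d t (wavePacket hQ hQt)
      = (Lp.fourierTransformₗᵢ (Space d) ℂ).symm g := by
    have : freeEvolution d t (wavePacket hQ hQt) = (Lp.fourierTransformₗᵢ (Space d) ℂ).symm
        (mulOp (freeSymbol t) (Lp.fourierTransformₗᵢ (Space d) ℂ (wavePacket hQ hQt))) := rfl
    rw [this, wavePacket, LinearIsometryEquiv.apply_symm_apply]
  rw [h0]
  filter_upwards [fourierInv_coeFn_ae_eq g hint] with x hx
  rw [hx, Real.fourierInv_congr_ae hg' x, Real.fourierInv_eq', ← integral_const_mul,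
    ← integral_indicator hQ]
  refine integral_congr_ae (Eventually.of_forall fun ξ => ?_)
  by_cases h : ξ ∈ Q
  · simp only [h, indicator_of_mem, smul_eq_mul, freeSymbol, phase]
    rw [← mul_assoc, ← Complex.exp_add, mul_comm c]
    congr 2
    push_cast
    ring
  · simp [h]

/-- After the phase at one point `η` of `Q` is factored out, the real part of the integrand is a
cosine of an angle at most `1`, and `cos u ≥ 1 - u² / 2 ≥ 1 / 2`. -/
theorem half_measure_le_norm_integral_exp {α : Type*} [MeasurableSpace α] {μ : Measure α}
    {Q : Set α} (hQ : MeasurableSet Q) (hQt : μ Q ≠ ∞) {θ : α → ℝ} (hθ : Measurable θ)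
    (h : ∀ ξ ∈ Q, ∀ η ∈ Q, |θ ξ - θ η| ≤ 1) :
    μ.real Q / 2 ≤ ‖∫ ξ in Q, Complex.exp (θ ξ * Complex.I) ∂μ‖ := by
  rcases Q.eq_empty_or_nonempty with rfl | ⟨η, hη⟩
  · simp
  have hi : IntegrableOn (fun ξ => Complex.exp ((θ ξ - θ η : ℝ) * Complex.I)) Q μ := by
    refine Integrable.mono' (g := fun _ => (1 : ℝ)) (integrableOn_const hQt) ?_ ?_
    · exact (by fun_prop : Measurable fun ξ => Complex.exp ((θ ξ - θ η : ℝ) * Complex.I))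
        |>.aestronglyMeasurable
    · exact Eventually.of_forall fun ξ => (Complex.norm_exp_ofReal_mul_I _).le
  have e1 : ‖∫ ξ in Q, Complex.exp (θ ξ * Complex.I) ∂μ‖
      = ‖∫ ξ in Q, Complex.exp ((θ ξ - θ η : ℝ) * Complex.I) ∂μ‖ := by
    have : ∀ ξ, Complex.exp ((θ ξ - θ η : ℝ) * Complex.I)
        = Complex.exp ((-θ η : ℝ) * Complex.I) * Complex.exp (θ ξ * Complex.I) := by
      intro ξ
      rw [← Complex.exp_add]
      congr 1
      push_cast
      ring
    simp_rw [this]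
    rw [integral_const_mul, norm_mul, Complex.norm_exp_ofReal_mul_I, one_mul]
  rw [e1]
  refine le_trans ?_ (Complex.re_le_norm _)
  have e2 := integral_re hi
  simp only [RCLike.re_to_complex, Complex.exp_ofReal_mul_I_re] at e2
  rw [← e2]
  have hc : IntegrableOn (fun ξ => Real.cos (θ ξ - θ η)) Q μ := by
    have h1 := hi.re
    simp only [RCLike.re_to_complex, Complex.exp_ofReal_mul_I_re] at h1
    exact h1
  calc μ.real Q / 2 = ∫ _ in Q, (1 / 2 : ℝ) ∂μ := by
        rw [setIntegral_const, smul_eq_mul]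
        ring
    _ ≤ _ := by
        refine setIntegral_mono_on (integrableOn_const hQt) hc hQ fun ξ hξ => ?_
        have h1 := Real.one_sub_sq_div_two_le_cos (x := θ ξ - θ η)
        have h2 := (sq_le_one_iff_abs_le_one _).2 (h ξ hξ η hη)
        linarith

theorem quarter_measure_le_norm_sq_freeEvolution {d : ℕ} {Q : Set (Space d)}
    (hQ : MeasurableSet Q) (hQt : volume Q ≠ ∞) (t : ℝ) :
    ∀ᵐ x, (∀ ξ ∈ Q, ∀ η ∈ Q, |phase t x ξ - phase t x η| ≤ 1) →
      volume.real Q / 4 ≤ ‖freeEvolution d t (wavePacket hQ hQt) x‖ ^ 2 := by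
  filter_upwards [freeEvolution_wavePacket_ae_eq hQ hQt t] with x hx h
  have h1 := half_measure_le_norm_integral_exp hQ hQt (continuous_phase t x).measurable h
  rw [hx, norm_mul, mul_pow, Complex.norm_real, Real.norm_of_nonneg (by positivity), inv_pow,
    Real.sq_sqrt measureReal_nonneg]
  -- For null `Q` the inverse is `0` by default and the bound reads `0 ≤ 0`.
  rcases (measureReal_nonneg (μ := volume) (s := Q)).eq_or_lt with h0 | h0
  · rw [← h0]
    simp
  · calc volume.real Q / 4 = (volume.real Q)⁻¹ * (volume.real Q / 2) ^ 2 := by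
          field_simp
          norm_num
      _ ≤ _ := by gcongr

/-- The phase is linear in the pair `(ξ, |ξ|²)`, with coefficients controlled by the size of `(t,
x)`; this is why cells must be localised in energy as well as in frequency. -/
theorem abs_phase_sub_le {d : ℕ} {t T δ : ℝ} {x ξ η : Space d} (ht : |t| ≤ T) (hx : ‖x‖ ≤ T)
    (h1 : ‖ξ - η‖ ≤ δ) (h2 : |‖ξ‖ ^ 2 - ‖η‖ ^ 2| ≤ δ) :
    |phase t x ξ - phase t x η| ≤ (2 * Real.pi + (2 * Real.pi) ^ 2) * T * δ := by
  have hT : 0 ≤ T := (abs_nonneg t).trans ht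
  have hδ : 0 ≤ δ := (norm_nonneg _).trans h1
  have e : phase t x ξ - phase t x η
      = 2 * Real.pi * ⟪ξ - η, x⟫_ℝ - (2 * Real.pi) ^ 2 * (t * (‖ξ‖ ^ 2 - ‖η‖ ^ 2)) := by
    rw [phase, phase, inner_sub_left]
    ring
  have h3 : |⟪ξ - η, x⟫_ℝ| ≤ δ * T :=
    (abs_real_inner_le_norm _ _).trans (by gcongr)
  have h4 : |t * (‖ξ‖ ^ 2 - ‖η‖ ^ 2)| ≤ T * δ := by
    rw [abs_mul]
    gcongr
  have hpi := Real.pi_pos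
  calc |phase t x ξ - phase t x η|
      ≤ |2 * Real.pi * ⟪ξ - η, x⟫_ℝ| + |(2 * Real.pi) ^ 2 * (t * (‖ξ‖ ^ 2 - ‖η‖ ^ 2))| := by
        rw [e]
        exact abs_sub _ _
    _ ≤ 2 * Real.pi * (δ * T) + (2 * Real.pi) ^ 2 * (T * δ) := by
        rw [abs_mul (2 * Real.pi), abs_mul ((2 * Real.pi) ^ 2),
          abs_of_pos (by positivity : 0 < 2 * Real.pi),
          abs_of_pos (by positivity : 0 < (2 * Real.pi) ^ 2)]
        gcongr
    _ = _ := by ring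

theorem integrable_of_memLinftyc {d : ℕ} {V : ℝ × Space d → ℝ} (hV : MemLinftyc V) :
    Integrable V := by
  obtain ⟨K, hK, hKV⟩ := hV.support
  have h1 : IntegrableOn V K := by
    have : IsFiniteMeasure (volume.restrict K) := ⟨by
      rw [Measure.restrict_apply_univ]
      exact hK.measure_lt_top⟩
    exact memLp_one_iff_integrable.1 ((hV.memLp.restrict K).mono_exponent le_top)
  refine ((integrable_indicator_iff hK.measurableSet).2 h1).congr ?_
  filter_upwards [hKV] with z hz
  by_cases h : z ∈ K
  · simp [h]
  · simp [h, hz h]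

theorem integral_pos_of_memLinftyc {d : ℕ} {V : ℝ × Space d → ℝ} (hV : MemLinftyc V)
    (hne : ¬ V =ᵐ[volume] 0) (h0 : ∀ᵐ z, 0 ≤ V z) : 0 < ∫ z, V z := by
  refine (integral_nonneg_of_ae h0).lt_of_ne fun h => hne ?_
  exact (integral_eq_zero_iff_of_nonneg_ae h0 (integrable_of_memLinftyc hV)).1 h.symm

/-- Needed for monotonicity of the integral, since a non-integrable upper bound would have integral
`0` by default. -/
theorem integrable_integral_mul_norm_sq {d : ℕ} {V : ℝ × Space d → ℝ} (hV : MemLinftyc V)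
    (f : L2 d) : Integrable fun t : ℝ => ∫ x, V (t, x) * ‖freeEvolution d t f x‖ ^ 2 := by
  refine ((integrable_evolvedPotential hV f).const_inner (𝕜 := ℂ) f).re.congr ?_
  filter_upwards [inner_evolvedPotential hV f] with t ht
  rw [ht]
  simp

theorem integrable_mul_norm_sq {d : ℕ} {φ : Space d → ℝ}
    (hφ : MemLp (fun x => (φ x : ℂ)) ∞ volume) (f : L2 d) :
    Integrable fun x => φ x * ‖f x‖ ^ 2 := by
  refine (L2.integrable_inner (𝕜 := ℂ) f (mulOp (fun x => (φ x : ℂ)) f)).re.congr ?_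
  filter_upwards [coeFn_mulOp hφ f] with x h
  rw [h]
  simp only [RCLike.inner_apply, mul_assoc, Complex.mul_conj']
  norm_cast

/-- The average of a non-zero, non-negative potential in a wave packet which is sufficiently
concentrated, in frequency and in energy, is at least of the order of the volume of the packet. -/
theorem exists_mul_measure_le_inner_timeAverage {d : ℕ} {V : ℝ × Space d → ℝ}
    (hV : MemLinftyc V) (hne : ¬ V =ᵐ[volume] 0) (h0 : ∀ᵐ z, 0 ≤ V z) :
    ∃ c > 0, ∃ δ > 0, ∀ (Q : Set (Space d)) (hQ : MeasurableSet Q) (hQt : volume Q ≠ ∞),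
      (∀ ξ ∈ Q, ∀ η ∈ Q, ‖ξ - η‖ ≤ δ ∧ |‖ξ‖ ^ 2 - ‖η‖ ^ 2| ≤ δ) →
      c * volume.real Q
        ≤ RCLike.re ⟪wavePacket hQ hQt, timeAverage V hV (wavePacket hQ hQt)⟫_ℂ := by
  obtain ⟨K, hK, hKV⟩ := hV.support
  obtain ⟨T, hT⟩ := hK.isBounded.exists_norm_le
  set T' := max T 0 + 1 with hT'
  have hT'0 : 0 < T' := by positivity
  have hpi := Real.pi_pos
  -- `M δ` bounds the phase oscillation over the support of `V`, so `δ = M⁻¹` makes it at most `1`.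
  set M := (2 * Real.pi + (2 * Real.pi) ^ 2) * T' with hM
  have hM0 : 0 < M := by positivity
  have hI := integral_pos_of_memLinftyc hV hne h0
  have hVi := integrable_of_memLinftyc hV
  refine ⟨(∫ z, V z) / 4, by positivity, M⁻¹, by positivity, fun Q hQ hQt hosc => ?_⟩
  rw [inner_timeAverage_eq_integral hV, RCLike.re_to_complex, Complex.ofReal_re]
  have e : (∫ z, V z) / 4 * volume.real Q
      = ∫ t : ℝ, ∫ x : Space d, V (t, x) * (volume.real Q / 4) := by
    rw [← integral_prod (f := fun z => V z * (volume.real Q / 4)) (hVi.mul_const _),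
      integral_mul_const, Measure.volume_eq_prod]
    ring
  rw [e]
  refine integral_mono_of_nonneg ?_ (integrable_integral_mul_norm_sq hV _) ?_
  · filter_upwards [Measure.ae_ae_of_ae_prod h0] with t ht
    refine integral_nonneg_of_ae ?_
    filter_upwards [ht] with x hx
    positivity
  · filter_upwards [Measure.ae_ae_of_ae_prod h0, Measure.ae_ae_of_ae_prod hKV,
      memLp_top_slice hV] with t h0t hKt hVt
    refine integral_mono_of_nonneg ?_ (integrable_mul_norm_sq hVt _) ?_
    · filter_upwards [h0t] with x hx
      positivity
    · filter_upwards [h0t, hKt, quarter_measure_le_norm_sq_freeEvolution hQ hQt t]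
        with x h0x hKx hx
      by_cases hz : (t, x) ∈ K
      · have hn := (hT _ hz).trans (by rw [hT']; linarith [le_max_left T 0] : T ≤ T')
        rw [Prod.norm_def, max_le_iff] at hn
        refine mul_le_mul_of_nonneg_left (hx fun ξ hξ η hη => ?_) h0x
        refine (abs_phase_sub_le hn.1 hn.2 (hosc ξ hξ η hη).1 (hosc ξ hξ η hη).2).trans ?_
        exact (mul_inv_cancel₀ hM0.ne').le
      · simp [hKx hz]

/-! ### Cells localised in frequency and in energy -/

/-- The cube of side `s` with lowest corner `s n`. -/
def freqCube {d : ℕ} (s : ℝ) (n : Fin d → ℕ) : Set (Space d) :=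
  {ξ | ∀ i, ξ i ∈ Ico (s * n i) (s * (n i + 1))}

/-- The part of the cube `freqCube s n` where `|ξ|²` lies in `[δm, δ(m + 1))`. -/
def freqCell {d : ℕ} (s δ : ℝ) (p : (Fin d → ℕ) × ℕ) : Set (Space d) :=
  freqCube s p.1 ∩ {ξ | ⌊‖ξ‖ ^ 2 / δ⌋₊ = p.2}

theorem freqCube_eq_preimage {d : ℕ} (s : ℝ) (n : Fin d → ℕ) :
    freqCube s n = (WithLp.ofLp : Space d → Fin d → ℝ) ⁻¹'
      (Set.pi univ fun i => Ico (s * n i) (s * (n i + 1))) := by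
  ext ξ
  simp only [freqCube, mem_ofPred_eq, mem_preimage, mem_univ_pi]

theorem measurableSet_freqCube {d : ℕ} (s : ℝ) (n : Fin d → ℕ) :
    MeasurableSet (freqCube s n) := by
  rw [freqCube_eq_preimage]
  exact (PiLp.volume_preserving_ofLp (Fin d)).measurable
    (MeasurableSet.univ_pi fun i => measurableSet_Ico)

theorem measurableSet_freqCell {d : ℕ} (s δ : ℝ) (p : (Fin d → ℕ) × ℕ) :
    MeasurableSet (freqCell s δ p) := by
  refine (measurableSet_freqCube s p.1).inter ?_
  have : Measurable fun ξ : Space d => ⌊‖ξ‖ ^ 2 / δ⌋₊ := by fun_prop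
  exact this (measurableSet_singleton p.2)

theorem volume_freqCube {d : ℕ} {s : ℝ} (n : Fin d → ℕ) :
    volume (freqCube s n) = ENNReal.ofReal s ^ d := by
  rw [freqCube_eq_preimage, (PiLp.volume_preserving_ofLp (Fin d)).measure_preimage
    (MeasurableSet.univ_pi fun i => measurableSet_Ico).nullMeasurableSet, Real.volume_pi_Ico]
  have : ∀ a : ℝ, s * (a + 1) - s * a = s := fun a => by ring
  simp [this]

theorem volume_freqCell_ne_top {d : ℕ} (s δ : ℝ) (p : (Fin d → ℕ) × ℕ) :
    volume (freqCell s δ p) ≠ ∞ := by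
  refine ne_top_of_le_ne_top ?_ (measure_mono inter_subset_left)
  rw [volume_freqCube]
  finiteness

/-- Both indices of a cell are recovered from any of its points by taking floors. -/
theorem disjoint_freqCell {d : ℕ} {s : ℝ} (hs : 0 < s) (δ : ℝ) {p q : (Fin d → ℕ) × ℕ}
    (h : p ≠ q) : Disjoint (freqCell s δ p) (freqCell s δ q) := by
  have floor_eq : ∀ (k : ℕ) (x : ℝ), x ∈ Ico (s * k) (s * (k + 1)) → ⌊x / s⌋₊ = k := by
    intro k x hx
    have h1 : (k : ℝ) ≤ x / s := (le_div_iff₀' hs).2 hx.1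
    exact (Nat.floor_eq_iff ((Nat.cast_nonneg k).trans h1)).2 ⟨h1, (div_lt_iff₀' hs).2 hx.2⟩
  refine disjoint_left.2 fun ξ hp hq => h (Prod.ext (funext fun i => ?_) ?_)
  · rw [← floor_eq _ _ (hp.1 i), ← floor_eq _ _ (hq.1 i)]
  · exact hp.2.symm.trans hq.2

theorem freqCell_oscillation {d : ℕ} {s δ : ℝ} (hδ : 0 < δ) (hs : 0 < s) (hsδ : s * d ≤ δ)
    (p : (Fin d → ℕ) × ℕ) : ∀ ξ ∈ freqCell s δ p, ∀ η ∈ freqCell s δ p,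
      ‖ξ - η‖ ≤ δ ∧ |‖ξ‖ ^ 2 - ‖η‖ ^ 2| ≤ δ := by
  intro ξ hξ η hη
  constructor
  · refine le_trans ?_ hsδ
    have h1 : ‖ξ - η‖ ^ 2 ≤ s ^ 2 * d := by
      rw [EuclideanSpace.norm_sq_eq]
      calc ∑ i, ‖(ξ - η) i‖ ^ 2 ≤ ∑ _i : Fin d, s ^ 2 := by
            refine Finset.sum_le_sum fun i _ => ?_
            have h2 := hξ.1 i
            have h3 := hη.1 i
            rw [mem_Ico] at h2 h3
            have : ‖(ξ - η) i‖ ≤ s := by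
              rw [PiLp.sub_apply, Real.norm_eq_abs, abs_le]
              constructor <;> linarith
            gcongr
        _ = s ^ 2 * d := by simp [mul_comm]
    refine le_of_sq_le_sq (h1.trans ?_) (by positivity)
    rw [mul_pow]
    -- The diameter bound `s √d` is relaxed to `s d`.
    have : (d : ℝ) ≤ (d : ℝ) ^ 2 := by exact_mod_cast Nat.le_self_pow two_ne_zero d
    gcongr
  · have key : ∀ ζ ∈ freqCell s δ p, δ * p.2 ≤ ‖ζ‖ ^ 2 ∧ ‖ζ‖ ^ 2 < δ * (p.2 + 1) := by
      intro ζ hζ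
      have h1 := (Nat.floor_eq_iff (by positivity)).1 hζ.2
      exact ⟨(le_div_iff₀' hδ).1 h1.1, (div_lt_iff₀' hδ).1 h1.2⟩
    have h1 := key ξ hξ
    have h2 := key η hη
    rw [abs_le]
    constructor <;> linarith

/-- The cube with lowest corner `s n` meets `O(max n + 1)` of the energy shells. -/
theorem exists_energy_shells {d : ℕ} {s δ : ℝ} (hδ : 0 < δ) (hs : 0 < s) (n : Fin d → ℕ) {k : ℕ}
    (hk : ∀ i, n i ≤ k) : ∃ S : Finset ℕ, (S.card : ℝ) ≤ (2 * s ^ 2 * d / δ + 2) * (k + 1) ∧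
      freqCube s n ⊆ ⋃ m ∈ S, freqCell s δ (n, m) := by
  set a : ℝ := (∑ i, (s * n i) ^ 2) / δ with ha
  set b : ℝ := (∑ i, (s * (n i + 1)) ^ 2) / δ with hb
  have ha0 : 0 ≤ a := by positivity
  have hb0 : 0 ≤ b := by positivity
  -- On the cube `|ξ|² / δ` lies between its values `a` and `b` at the lowest and highest corners.
  -- As `(n i + 1)² - (n i)² ≤ 2 (k + 1)`, the gap `b - a` is linear in `k + 1`; rounding costs at
  -- most `2`.
  refine ⟨Finset.Icc ⌊a⌋₊ ⌊b⌋₊, ?_, ?_⟩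
  · have hba : b - a ≤ 2 * s ^ 2 * d / δ * (k + 1) := by
      rw [ha, hb, ← sub_div, ← Finset.sum_sub_distrib, div_mul_eq_mul_div]
      gcongr
      calc ∑ i, ((s * (n i + 1)) ^ 2 - (s * n i) ^ 2)
          ≤ ∑ _i : Fin d, 2 * s ^ 2 * (k + 1) := by
            refine Finset.sum_le_sum fun i _ => ?_
            have h1 : (n i : ℝ) ≤ k := by exact_mod_cast hk i
            have h2 := mul_le_mul_of_nonneg_left h1 (sq_nonneg s)
            have h3 := sq_nonneg s
            ring_nf at h2 ⊢
            linarith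
        _ = 2 * s ^ 2 * d * (k + 1) := by
            rw [Finset.sum_const, Finset.card_univ, Fintype.card_fin, nsmul_eq_mul]
            ring
    have h1 := Nat.floor_le hb0
    have h2 := Nat.lt_floor_add_one a
    have h3 : ((⌊b⌋₊ + 1 - ⌊a⌋₊ : ℕ) : ℝ) ≤ b - a + 2 := by
      rcases le_total ⌊a⌋₊ (⌊b⌋₊ + 1) with h | h
      · rw [Nat.cast_sub h]
        push_cast
        linarith
      · rw [Nat.sub_eq_zero_of_le h]
        have : a ≤ b := by
          rw [ha, hb]
          gcongr
          linarith
        push_cast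
        linarith
    rw [Nat.card_Icc]
    have hk0 : (0 : ℝ) ≤ k := Nat.cast_nonneg k
    linarith
  · intro ξ hξ
    simp only [mem_iUnion]
    refine ⟨⌊‖ξ‖ ^ 2 / δ⌋₊, Finset.mem_Icc.2 ⟨?_, ?_⟩, hξ, rfl⟩
    all_goals
      refine Nat.floor_le_floor ?_
      rw [EuclideanSpace.norm_sq_eq]
      refine div_le_div_of_nonneg_right (Finset.sum_le_sum fun i _ => ?_) hδ.le
      have h1 := hξ i
      rw [mem_Ico] at h1
      have h2 : 0 ≤ s * (n i : ℝ) := by positivity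
      rw [Real.norm_of_nonneg (h2.trans h1.1)]
    · exact pow_le_pow_left₀ h2 h1.1 2
    · exact pow_le_pow_left₀ (h2.trans h1.1) h1.2.le 2

/-- By convexity of `x ^ (d + 1)`, splitting total volume at least `s ^ d` into `N` pieces gives a
sum of powers at least `(c s ^ d) ^ (d + 1) / N ^ d`. -/
theorem le_tsum_volume_freqCell_pow {d : ℕ} {s δ : ℝ} (hδ : 0 < δ) (hs : 0 < s)
    (n : Fin d → ℕ) {k : ℕ} (hk : ∀ i, n i ≤ k) {c : ℝ} (hc : 0 ≤ c) :
    ENNReal.ofReal ((c * s ^ d) ^ (d + 1) / ((2 * s ^ 2 * d / δ + 2) * (k + 1)) ^ d)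
      ≤ ∑' m, ENNReal.ofReal ((c * volume.real (freqCell s δ (n, m))) ^ (d + 1)) := by
  obtain ⟨S, hS, hcover⟩ := exists_energy_shells hδ hs n hk
  refine le_trans ?_ (ENNReal.sum_le_tsum S)
  rw [← ENNReal.ofReal_sum_of_nonneg fun m _ => by positivity]
  refine ENNReal.ofReal_le_ofReal ?_
  have hsum : s ^ d ≤ ∑ m ∈ S, volume.real (freqCell s δ (n, m)) := by
    have h1 : volume.real (freqCube s n) = s ^ d := by
      rw [measureReal_def, volume_freqCube, ENNReal.toReal_pow, ENNReal.toReal_ofReal hs.le]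
    rw [← h1]
    refine (measureReal_mono hcover ?_).trans (measureReal_biUnion_finset_le _ _)
    exact (measure_biUnion_lt_top S.finite_toSet
      fun m _ => (volume_freqCell_ne_top s δ (n, m)).lt_top).ne
  have hpos : 0 < ∑ m ∈ S, volume.real (freqCell s δ (n, m)) := (pow_pos hs d).trans_le hsum
  have hcard : (0 : ℝ) < S.card := by
    rcases S.eq_empty_or_nonempty with rfl | h
    · simp at hpos
    · exact_mod_cast h.card_pos
  refine le_trans ?_ (pow_sum_div_card_le_sum_pow (fun m _ => by positivity) d)
  rw [← Finset.mul_sum]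
  gcongr

theorem tsum_ofReal_div_succ {A : ℝ} (hA : 0 < A) :
    ∑' k : ℕ, ENNReal.ofReal (A / ((k : ℝ) + 1)) = ∞ := by
  by_contra h
  have h1 := ENNReal.summable_toReal h
  have e : ∀ k : ℕ, (ENNReal.ofReal (A / ((k : ℝ) + 1))).toReal = A * (1 / ((k + 1 : ℕ) : ℝ)) := by
    intro k
    rw [ENNReal.toReal_ofReal (by positivity)]
    push_cast
    ring
  simp_rw [e] at h1
  rw [summable_mul_left_iff hA.ne', summable_nat_add_iff 1 (f := fun k : ℕ => 1 / (k : ℝ))] at h1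
  exact Real.not_summable_one_div_natCast h1

theorem tsum_volume_freqCell_pow {d : ℕ} (hd : 1 ≤ d) {s δ c : ℝ} (hδ : 0 < δ) (hs : 0 < s)
    (hc : 0 < c) :
    ∑' p : (Fin d → ℕ) × ℕ, ENNReal.ofReal ((c * volume.real (freqCell s δ p)) ^ (d + 1)) = ∞ := by
  obtain ⟨e, rfl⟩ : ∃ e, d = e + 1 := ⟨d - 1, by omega⟩
  set D : ℝ := (c * s ^ (e + 1)) ^ (e + 1 + 1) with hD
  set L : ℝ := 2 * s ^ 2 * (e + 1 : ℕ) / δ + 2 with hL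
  have hL0 : 0 < L := by positivity
  -- Only cubes whose first index `k` is the largest are kept: there are `(k + 1) ^ e` of them for
  -- each `k`, with `e = d - 1`, which leaves one factor `k + 1` in the denominator.
  let j : (Σ k : ℕ, Fin e → Fin (k + 1)) → (Fin (e + 1) → ℕ) :=
    fun q => Fin.cons q.1 fun i => (q.2 i : ℕ)
  have hj : Function.Injective j := by
    rintro ⟨k, n⟩ ⟨k', n'⟩ h
    obtain ⟨rfl, h2⟩ := Fin.cons_injective2 h
    simp only [Sigma.mk.injEq, heq_eq_eq, true_and]
    exact funext fun i => Fin.ext (congrFun h2 i)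
  rw [ENNReal.tsum_prod', eq_top_iff, ← tsum_ofReal_div_succ (A := D / L ^ (e + 1)) (by positivity)]
  refine le_trans ?_ (ENNReal.tsum_comp_le_tsum_of_injective hj _)
  rw [ENNReal.tsum_sigma']
  refine ENNReal.tsum_le_tsum fun k => ?_
  have hk : ∀ (n : Fin e → Fin (k + 1)) (i : Fin (e + 1)), j ⟨k, n⟩ i ≤ k := by
    intro n i
    refine Fin.cases ?_ (fun i => ?_) i
    · exact le_rfl
    · exact Nat.lt_succ_iff.1 (n i).2
  refine le_trans ?_ (ENNReal.tsum_le_tsum fun n =>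
    le_tsum_volume_freqCell_pow hδ hs (j ⟨k, n⟩) (hk n) hc.le)
  rw [tsum_fintype, Finset.sum_const, Finset.card_univ, Fintype.card_fun, Fintype.card_fin,
    Fintype.card_fin, ← ENNReal.ofReal_nsmul, nsmul_eq_mul]
  refine ENNReal.ofReal_le_ofReal (le_of_eq ?_)
  rw [← hD, ← hL]
  have hk0 : (k : ℝ) + 1 ≠ 0 := by positivity
  push_cast
  rw [mul_pow L, pow_succ ((k : ℝ) + 1)]
  field_simp

theorem orthonormal_wavePacket {d : ℕ} {ι : Type*} {Q : ι → Set (Space d)}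
    (hQ : ∀ i, MeasurableSet (Q i)) (hQt : ∀ i, volume (Q i) ≠ ∞) (hQ0 : ∀ i, volume (Q i) ≠ 0)
    (hdisj : ∀ i j, i ≠ j → Disjoint (Q i) (Q j)) :
    Orthonormal ℂ fun i => wavePacket (hQ i) (hQt i) :=
  ⟨fun i => norm_wavePacket _ _ (hQ0 i),
    fun i j hij => inner_wavePacket_of_disjoint _ _ _ _ (hdisj i j hij)⟩

/-- A lower bound on the trace of a power of a non-negative operator, from its averages in wave
packets with disjoint Fourier supports. -/
theorem tsum_measure_pow_le_posTrace {d : ℕ} {B : L2 d →L[ℂ] L2 d} (hB : B.IsPositive)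
    {ι : Type*} {Q : ι → Set (Space d)} (hQ : ∀ i, MeasurableSet (Q i))
    (hQt : ∀ i, volume (Q i) ≠ ∞) (hdisj : ∀ i j, i ≠ j → Disjoint (Q i) (Q j)) {c : ℝ}
    (hc : 0 ≤ c) (h : ∀ i, c * volume.real (Q i)
      ≤ RCLike.re ⟪wavePacket (hQ i) (hQt i), B (wavePacket (hQ i) (hQt i))⟫_ℂ) (n : ℕ) :
    ∑' i, ENNReal.ofReal ((c * volume.real (Q i)) ^ (n + 1)) ≤ posTrace (B ^ (n + 1)) := by
  -- Null sets carry no normalised packet; they are discarded, since their terms in the sum vanish.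
  have hv := orthonormal_wavePacket (ι := {i // volume (Q i) ≠ 0}) (fun i => hQ i)
    (fun i => hQt i) (fun i => i.2) (fun i j hij => hdisj i j fun h => hij (Subtype.ext h))
  have hsupp : (Function.support fun i => ENNReal.ofReal ((c * volume.real (Q i)) ^ (n + 1)))
      ⊆ {i | volume (Q i) ≠ 0} := by
    intro i hi h
    refine hi ?_
    simp only [measureReal_def, h, ENNReal.toReal_zero, mul_zero, zero_pow (Nat.succ_ne_zero n),
      ENNReal.ofReal_zero]
  rw [← tsum_subtype_eq_of_support_subset hsupp]
  refine le_trans (ENNReal.tsum_le_tsum fun i => ENNReal.ofReal_le_ofReal ?_)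
    (tsum_le_posTrace (isPositive_pow hB (n + 1)) hv)
  exact (pow_le_pow_left₀ (by positivity) (h i) (n + 1)).trans (re_inner_pow_le hB (hv.1 i) n)

theorem posTrace_timeAverage_pow_eq_top {d : ℕ} (hd : 1 ≤ d) {V : ℝ × Space d → ℝ}
    (hV : MemLinftyc V) (hne : ¬ V =ᵐ[volume] 0) (h0 : ∀ᵐ z, 0 ≤ V z) :
    posTrace (timeAverage V hV ^ (d + 1)) = ∞ := by
  obtain ⟨c, hc, δ, hδ, hB⟩ := exists_mul_measure_le_inner_timeAverage hV hne h0
  have hd0 : (0 : ℝ) < d := by exact_mod_cast hd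
  -- The side `s = δ / d` satisfies the condition `s d ≤ δ` of `freqCell_oscillation`.
  have hs0 : 0 < δ / d := by positivity
  rw [eq_top_iff, ← tsum_volume_freqCell_pow hd hδ hs0 hc]
  exact tsum_measure_pow_le_posTrace (isPositive_timeAverage hV h0)
    (measurableSet_freqCell (δ / d) δ) (volume_freqCell_ne_top (δ / d) δ)
    (fun _ _ => disjoint_freqCell hs0 δ) hc.le
    (fun p => hB _ _ _ (freqCell_oscillation hδ hs0 (div_mul_cancel₀ δ hd0.ne').le p)) d

/-! ### Failure of the dual Strichartz inequality at the end point -/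

/-- The indicator of the product of the unit balls of `ℝ` and `ℝᵈ`. -/
def unitPotential (d : ℕ) : ℝ × Space d → ℝ :=
  (Metric.closedBall (0 : ℝ) 1 ×ˢ Metric.closedBall (0 : Space d) 1).indicator fun _ => 1

theorem unitPotential_nonneg {d : ℕ} (z : ℝ × Space d) : 0 ≤ unitPotential d z :=
  indicator_nonneg (fun _ _ => zero_le_one) z

theorem memLinftyc_unitPotential (d : ℕ) : MemLinftyc (unitPotential d) where
  memLp := memLp_indicator_const _
    (Metric.isClosed_closedBall.measurableSet.prod Metric.isClosed_closedBall.measurableSet) _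
    (Or.inr (((isCompact_closedBall _ _).prod (isCompact_closedBall _ _)).measure_lt_top.ne))
  support := ⟨_, (isCompact_closedBall _ _).prod (isCompact_closedBall _ _),
    Eventually.of_forall fun _ hz => indicator_of_notMem hz _⟩

theorem unitPotential_ne_zero (d : ℕ) : ¬ unitPotential d =ᵐ[volume] 0 := by
  intro h
  have h1 : volume (Metric.closedBall (0 : ℝ) 1 ×ˢ Metric.closedBall (0 : Space d) 1) = 0 := by
    refine measure_mono_null (fun z hz => ?_) (ae_iff.1 h)
    simpa [unitPotential] using hz
  rw [closedBall_prod_same] at h1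
  exact (Metric.measure_closedBall_pos volume _ one_pos).ne' h1

theorem mixedNorm_unitPotential_ne_top (d : ℕ) {p : ℝ} (hp : 0 < p) (q : ℝ) :
    mixedNorm p q (unitPotential d) ≠ ∞ := by
  set N := eLpNorm ((Metric.closedBall (0 : Space d) 1).indicator fun _ => (1 : ℝ))
    (ENNReal.ofReal q) volume with hN
  have hNt : N ≠ ∞ := (memLp_indicator_const _ Metric.isClosed_closedBall.measurableSet _
    (Or.inr (isCompact_closedBall _ _).measure_lt_top.ne)).2.ne
  have e : (fun t : ℝ => eLpNorm (fun x => unitPotential d (t, x)) (ENNReal.ofReal q) volume)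
      = (Metric.closedBall (0 : ℝ) 1).indicator fun _ => N := by
    ext t
    by_cases ht : t ∈ Metric.closedBall (0 : ℝ) 1
    · rw [indicator_of_mem ht, hN]
      congr 1
      ext x
      by_cases hx : x ∈ Metric.closedBall (0 : Space d) 1
      · rw [indicator_of_mem hx]
        exact indicator_of_mem (mk_mem_prod ht hx) _
      · rw [indicator_of_notMem hx]
        exact indicator_of_notMem (fun h => hx h.2) _
    · rw [indicator_of_notMem ht]
      have : (fun x : Space d => unitPotential d (t, x)) = 0 := by
        ext x
        exact indicator_of_notMem (fun h => ht h.1) _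
      rw [this, eLpNorm_zero]
  rw [mixedNorm, e, eLpNorm_indicator_const Metric.isClosed_closedBall.measurableSet
    (by simpa using hp) ENNReal.ofReal_ne_top]
  refine ENNReal.mul_ne_top (by simpa using hNt) (ENNReal.rpow_ne_top_of_nonneg (by positivity) ?_)
  exact (isCompact_closedBall _ _).measure_lt_top.ne

theorem not_dualStrichartz {d : ℕ} (hd : 1 ≤ d) :
    ¬ DualStrichartz d ((d : ℝ) + 1) (((d : ℝ) + 1) / 2) := by
  rintro ⟨C, hC⟩
  have hV := memLinftyc_unitPotential d
  have h0 : ∀ᵐ z, 0 ≤ unitPotential d z := Eventually.of_forall unitPotential_nonneg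
  have h := hC (unitPotential d) hV
  rw [mul_div_cancel₀ _ two_ne_zero, schattenNorm_eq_top (isPositive_timeAverage hV h0)
    (posTrace_timeAverage_pow_eq_top hd hV (unitPotential_ne_zero d) h0)] at h
  exact ENNReal.mul_ne_top ENNReal.coe_ne_top
    (mixedNorm_unitPotential_ne_top d (by positivity) _) (top_le_iff.1 h)

end

end EndPoint

theorem mainTheorem6 (d : ℕ) (hd : 1 ≤ d) :
    (∀ (V : ℝ × EndPoint.Space d → ℝ) (hV : EndPoint.MemLinftyc V),
      ¬ (V =ᵐ[MeasureTheory.volume] 0) →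
      (∀ᵐ z, 0 ≤ V z) →
      (∀ (ω : ℝ) (k : EndPoint.Space d),
        0 ≤ (EndPoint.spaceTimeFourier V ω k).re ∧ (EndPoint.spaceTimeFourier V ω k).im = 0) →
      (EndPoint.timeAverage V hV ^ (d + 1)).IsPositive ∧
        EndPoint.posTrace (EndPoint.timeAverage V hV ^ (d + 1)) = ⊤) ∧
    ¬ EndPoint.DualStrichartz d ((d : ℝ) + 1) (((d : ℝ) + 1) / 2) :=
  ⟨fun _ hV hne h0 _ =>
    ⟨EndPoint.isPositive_pow (EndPoint.isPositive_timeAverage hV h0) (d + 1),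
      EndPoint.posTrace_timeAverage_pow_eq_top hd hV hne h0⟩, EndPoint.not_dualStrichartz hd⟩
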